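/- Let $P$ be a triangulated polyhedron in $\mathbb{R}^3$: a finite closed connected triangulated surface whose vertices are placed in $\mathbb{R}^3$, self-intersections being allowed. Assume that the edges of $P$ form an isostatic bar framework, that is, every infinitesimal motion of the framework is induced by a rigid motion, and the rows of its rigidity matrix are linearly independent. Let $\triangle ABA'$ and $\triangle AA'B'$ be two faces of $P$ (so $B\neq B'$ as vertices) meeting along the edge $AA'$, such that the edge lengths satisfy $AB=AB'$ and $A'B=A'B'$. Then there is a plane $\pi$ through $A$ and $A'$ such that the reflection in $\pi$ swaps $B$ and $B'$. For every such plane $\pi$, let $T$ be the twinned polyhedron of $P$ around the equator $ABA'B'$: remove the edge $AA'$ and the two faces along it from $P$ to obtain a cap with boundary $ABA'B'$, and glue this cap to its mirror image in $\pi$ along the common boundary (the mirror images of $A,B,A',B'$ are identified with $A,B',A',B$ respectively; all other vertices are doubled). Then $T$ has a single flex. Here a placement of the vertices of $T$ is called admissible if it gives every edge of $T$ the same length as in $T$. That $T$ has a single flex means: there is a continuous one-parameter family $\gamma(t)$, $-\varepsilon<t<\varepsilon$ with $\varepsilon>0$, of admissible placements, with $\gamma(0)$ the placement of $T$ itself,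 such that no two distinct members of the family differ by a rigid motion (a composition of rotations and translations), and every admissible placement sufficiently close to that of $T$ is obtained by a rigid motion from some $\gamma(t)$. -/

import Mathlib

open Set Topology

/-- Euclidean three-space. -/
abbrev Space3 : Type := EuclideanSpace ℝ (Fin 3)

/-! ### Bar frameworks in three-space -/

section Frameworks

variable {V : Type*}

/-- The row of the rigidity matrix belonging to the bar between `i` and `j`: the linear functional
`u ↦ ⟪p i - p j, u i - u j⟫` on the velocity fields `u`. -/
noncomputable def barRow (p : V → Space3) (i j : V) : (V → Space3) →ₗ[ℝ] ℝ :=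
  (innerₗ Space3 (p i - p j)).comp
    ((LinearMap.proj i : (V → Space3) →ₗ[ℝ] Space3) - LinearMap.proj j)

theorem barRow_apply (p : V → Space3) (i j : V) (u : V → Space3) :
    barRow p i j u = inner ℝ (p i - p j) (u i - u j) := rfl

theorem barRow_comm (p : V → Space3) (i j : V) : barRow p i j = barRow p j i := by
  refine LinearMap.ext fun u => ?_
  rw [barRow_apply, barRow_apply, ← neg_sub (p j), ← neg_sub (u j), inner_neg_neg]

/-- The rows of the rigidity matrix, indexed by unordered pairs of vertices. -/
noncomputable def rigidityRow (p : V → Space3) : Sym2 V → ((V → Space3) →ₗ[ℝ] ℝ) :=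
  Sym2.lift ⟨barRow p, barRow_comm p⟩

/-- A velocity field that preserves every bar length to first order. -/
def IsInfinitesimalMotion (G : SimpleGraph V) (p u : V → Space3) : Prop :=
  ∀ i j, G.Adj i j → inner ℝ (p i - p j) (u i - u j) = 0

/-- A velocity field induced by a rigid motion: a skew-symmetric linear map plus a translation. -/
def IsTrivialMotion (p u : V → Space3) : Prop :=
  ∃ (S : Space3 →ₗ[ℝ] Space3) (b : Space3),
    (∀ x y, inner ℝ (S x) y = -inner ℝ x (S y)) ∧ ∀ v, u v = S (p v) + b

/-- A framework is isostatic if it is infinitesimally rigid and its bars are independent, that is,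
the rows of its rigidity matrix are linearly independent. -/
def IsIsostaticFramework (G : SimpleGraph V) (p : V → Space3) : Prop :=
  (∀ u, IsInfinitesimalMotion G p u → IsTrivialMotion p u) ∧
    LinearIndependent ℝ (fun e : G.edgeSet => rigidityRow p e)

/-- The placement `q` gives every bar the same length as the placement `p` does. -/
def SameBarLengths (G : SimpleGraph V) (p q : V → Space3) : Prop :=
  ∀ i j, G.Adj i j → dist (q i) (q j) = dist (p i) (p j)

/-- The placements `p` and `q` differ by a composition of rotations and translations
(an orientation-preserving isometry of space). -/
def RigidlyEquivalent (p q : V → Space3) : Prop :=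
  ∃ g : Space3 ≃ᵃⁱ[ℝ] Space3,
    LinearMap.det (g.linearIsometryEquiv.toLinearEquiv : Space3 →ₗ[ℝ] Space3) = 1 ∧
      ∀ v, q v = g (p v)

/-- The framework has a single flex: it moves in a continuous one-parameter family of placements
with the same bar lengths, passing through the given placement, no two of whose members differ by
a rigid motion, and every placement close to the given one with the same bar lengths is, up to a
rigid motion, a member of this family. -/
def HasSingleFlexFramework (G : SimpleGraph V) (p : V → Space3) : Prop :=
  ∃ (ε : ℝ) (γ : ℝ → V → Space3), 0 < ε ∧ ContinuousOn γ (Ioo (-ε) ε) ∧ γ 0 = p ∧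
    (∀ t ∈ Ioo (-ε) ε, SameBarLengths G p (γ t)) ∧
    (∀ s ∈ Ioo (-ε) ε, ∀ t ∈ Ioo (-ε) ε, RigidlyEquivalent (γ s) (γ t) → s = t) ∧
    ∃ U ∈ 𝓝 p, ∀ q ∈ U, SameBarLengths G p q → ∃ t ∈ Ioo (-ε) ε, RigidlyEquivalent (γ t) q

end Frameworks

/-! ### Triangulated polyhedra -/

/-- A collection of triangles, given by their vertex sets, with a placement of the vertices in
space. Self-intersections are allowed. -/
structure TriangulatedFigure (V : Type*) where
  faces : Finset (Finset V)
  pos : V → Space3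

namespace TriangulatedFigure

variable {V : Type*}

/-- The vertices and edges of the faces. -/
def edgeGraph (P : TriangulatedFigure V) : SimpleGraph V where
  Adj u v := u ≠ v ∧ ∃ f ∈ P.faces, u ∈ f ∧ v ∈ f
  symm := ⟨fun _ _ h => ⟨h.1.symm, h.2.imp fun _ hf => ⟨hf.1, hf.2.2, hf.2.1⟩⟩⟩
  loopless := ⟨fun _ h => h.1 rfl⟩

/-- The faces form a triangulated polyhedron (a closed connected triangulated surface): all faces
are triangles, every vertex lies on a face, every edge lies on exactly two faces, any two faces at
a vertex are joined by a chain of faces at that vertex in which consecutive ones share an edge, and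
the edge graph is connected. -/
structure IsPolyhedron [DecidableEq V] (P : TriangulatedFigure V) : Prop where
  card_face : ∀ f ∈ P.faces, f.card = 3
  exists_face : ∀ v, ∃ f ∈ P.faces, v ∈ f
  two_faces : ∀ u v, P.edgeGraph.Adj u v → (P.faces.filter fun f => u ∈ f ∧ v ∈ f).card = 2
  link_connected : ∀ v, ∀ f ∈ P.faces, ∀ g ∈ P.faces, v ∈ f → v ∈ g →
    Relation.ReflTransGen (fun a b => b ∈ P.faces ∧ v ∈ b ∧ (a ∩ b).card = 2) f g
  connected : P.edgeGraph.Connected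

/-- The edges of the figure form an isostatic framework. -/
def IsIsostatic (P : TriangulatedFigure V) : Prop :=
  IsIsostaticFramework P.edgeGraph P.pos

/-- The figure, with its edges as rigid bars, has a single flex. -/
def HasSingleFlex (P : TriangulatedFigure V) : Prop :=
  HasSingleFlexFramework P.edgeGraph P.pos

end TriangulatedFigure

/-! ### Twinning by a reflection -/

/-- A plane in three-space. -/
structure MirrorPlane where
  carrier : AffineSubspace ℝ Space3
  nonempty : Nonempty carrier
  finrank_direction : Module.finrank ℝ carrier.direction = 2

namespace MirrorPlane

/-- The reflection in the plane. -/
noncomputable def reflection (π : MirrorPlane) : Space3 ≃ᵃⁱ[ℝ] Space3 :=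
  haveI := π.nonempty
  EuclideanGeometry.reflection π.carrier

/-- The plane passes through `a` and `a'`, and the reflection in it swaps `b` and `b'`. -/
def IsSymmetryPlane (π : MirrorPlane) (a b a' b' : Space3) : Prop :=
  a ∈ π.carrier ∧ a' ∈ π.carrier ∧ π.reflection b = b' ∧ π.reflection b' = b

end MirrorPlane

namespace TriangulatedFigure

variable {V : Type*} [DecidableEq V]

/-- The faces that remain after the edge `AA'` and the two faces along it are removed. -/
def capFaces (P : TriangulatedFigure V) (A B A' B' : V) : Finset (Finset V) :=
  P.faces \ {{A, B, A'}, {A, A', B'}}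

/-- The vertices of the twinned polyhedron: the vertices of the cap, and a second copy of those
that are not on the equator `ABA'B'`. -/
abbrev TwinVertex (A B A' B' : V) : Type _ :=
  V ⊕ {v : V // v ∉ ({A, B, A', B'} : Finset V)}

/-- The vertex of the twinned polyhedron that a vertex of the mirror image of the cap becomes:
the mirror images of `A`, `B`, `A'`, `B'` are glued to `A`, `B'`, `A'`, `B` respectively. -/
def mirrorVertex (A B A' B' v : V) : TwinVertex A B A' B' :=
  if h : v ∈ ({A, B, A', B'} : Finset V) then Sum.inl (Equiv.swap B B' v) else Sum.inr ⟨v, h⟩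

/-- The twinned polyhedron: the cap and its mirror image in the plane `π`, glued along the equator
`ABA'B'`. -/
noncomputable def twin (P : TriangulatedFigure V) (A B A' B' : V) (π : MirrorPlane) :
    TriangulatedFigure (TwinVertex A B A' B') where
  faces :=
    (P.capFaces A B A' B').image (Finset.image Sum.inl) ∪
      (P.capFaces A B A' B').image (Finset.image (mirrorVertex A B A' B'))
  pos := Sum.elim P.pos fun v => π.reflection (P.pos v)

end TriangulatedFigure

/-! In an isostatic framework the map from placements to squared bar lengths has a surjective
derivative, so all bars except `AA'` can keep their lengths while the squared length of `AA'` grows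
linearly in a parameter `t`. Infinitesimal rigidity makes this map injective near `P` once a
triangle is pinned. Hence the cap has a single flex `γ`, and the distance of `A` and `A'` determines
`t` (`IsIsostaticFramework.exists_flex`).

Along `γ` the four sides of the equator keep their lengths, so the triangles `AA'B` and `AA'B'` stay
congruent. The orientation-reversing isometry that fixes `A` and `A'` and maps `B` to `B'` also maps
`B'` to `B` (`affineIsometry_swap`). The image of the flexed cap under it therefore fits the flexed
cap along the equator, and both together flex the twin. At `t = 0` this isometry is the reflection
in `π`.

Conversely, an admissible placement near `T` restricts to two caps. The first, and the second
reflected back in `π`, are each rigidly equivalent to a member of `γ`. They share the distance of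
`A` and `A'`, so the parameters agree, and they share the equator, so
`affineIsometry_eq_of_triangle` fixes their relative position.

The isometries aligning congruent triangles are given by an explicit formula, `alignVec`, so that
their continuity in the data can be read off. -/

/-! ### Cross products and alignment of triangles -/

/-- The cross product on Euclidean three-space. -/
noncomputable def cross3 (u v : Space3) : Space3 :=
  WithLp.toLp 2 (crossProduct u.ofLp v.ofLp)

theorem inner_space3 (u v : Space3) : inner ℝ u v = u 0 * v 0 + u 1 * v 1 + u 2 * v 2 := by
  simp [PiLp.inner_apply, Fin.sum_univ_three, mul_comm]

theorem cross3_zero (u v : Space3) : cross3 u v 0 = u 1 * v 2 - u 2 * v 1 := by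
  simp [cross3, cross_apply]

theorem cross3_one (u v : Space3) : cross3 u v 1 = u 2 * v 0 - u 0 * v 2 := by
  simp [cross3, cross_apply]

theorem cross3_two (u v : Space3) : cross3 u v 2 = u 0 * v 1 - u 1 * v 0 := by
  simp [cross3, cross_apply]

theorem inner_left_cross3 (u v : Space3) : inner ℝ u (cross3 u v) = 0 := by
  simp only [inner_space3, cross3_zero, cross3_one, cross3_two]; ring

theorem inner_right_cross3 (u v : Space3) : inner ℝ v (cross3 u v) = 0 := by
  simp only [inner_space3, cross3_zero, cross3_one, cross3_two]; ring

theorem inner_cross3_swap (x u v : Space3) :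
    inner ℝ x (cross3 u v) = -inner ℝ v (cross3 u x) := by
  simp only [inner_space3, cross3_zero, cross3_one, cross3_two]; ring

theorem inner_cross3_self (u v : Space3) :
    inner ℝ (cross3 u v) (cross3 u v) = inner ℝ u u * inner ℝ v v - inner ℝ u v ^ 2 := by
  simp only [inner_space3, cross3_zero, cross3_one, cross3_two]; ring

theorem cross3_cross3_left (u v : Space3) :
    cross3 (cross3 u v) u = inner ℝ u u • v - inner ℝ u v • u := by
  ext i
  simp only [PiLp.sub_apply, PiLp.smul_apply, smul_eq_mul]
  fin_cases i <;>
  simp only [inner_space3, cross3_zero, cross3_one, cross3_two, Fin.zero_eta, Fin.mk_one,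
    Fin.reduceFinMk] <;> ring

theorem zero_cross3 (u : Space3) : cross3 0 u = 0 := by
  simp [cross3]

theorem inner_cross3_self_ne_zero {u v : Space3} (h : cross3 u v ≠ 0) :
    inner ℝ (cross3 u v) (cross3 u v) ≠ 0 := fun h0 => h (inner_self_eq_zero.1 h0)

/-- The transpose puts the vectors into columns, so that a linear map acts by multiplication from
the left. -/
theorem inner_cross3_eq_det (x u v : Space3) :
    inner ℝ x (cross3 u v) = (Matrix.of ![x.ofLp, u.ofLp, v.ofLp]).transpose.det := by
  rw [Matrix.det_transpose, Matrix.det_fin_three]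
  simp only [inner_space3, cross3_zero, cross3_one, cross3_two, Matrix.of_apply, Matrix.cons_val]
  ring

theorem continuous_cross3 : Continuous fun x : Space3 × Space3 => cross3 x.1 x.2 := by
  unfold cross3
  refine (PiLp.continuous_toLp 2 _).comp (continuous_pi fun i => ?_)
  fin_cases i <;> simp [cross_apply] <;> fun_prop

/-- The linear map that sends `u`, `v`, `cross3 u v` to `u'`, `v'`, `σ • cross3 u' v'`, if the first
three vectors form a basis. -/
noncomputable def alignVec (σ : ℝ) (u v u' v' z : Space3) : Space3 :=
  (inner ℝ (cross3 u v) (cross3 u v))⁻¹ •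
    ((inner ℝ v v * inner ℝ z u - inner ℝ u v * inner ℝ z v) • u' +
      (inner ℝ u u * inner ℝ z v - inner ℝ u v * inner ℝ z u) • v' +
      (σ * inner ℝ z (cross3 u v)) • cross3 u' v')

/-- Cramer's rule for the coordinates of `z` in the basis `u`, `v`, `cross3 u v`; the denominator is
the Gram determinant of `u` and `v`. -/
theorem alignVec_self {u v : Space3} (h : cross3 u v ≠ 0) (z : Space3) :
    alignVec 1 u v u v z = z := by
  rw [alignVec, inv_smul_eq_iff₀ (inner_cross3_self_ne_zero h)]
  ext i
  simp only [PiLp.add_apply, PiLp.smul_apply, smul_eq_mul]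
  fin_cases i <;>
  simp only [inner_space3, cross3_zero, cross3_one, cross3_two, Fin.zero_eta, Fin.mk_one,
    Fin.reduceFinMk] <;> ring

/-- A vector that is orthogonal to `u`, `v` and their nonzero cross product vanishes. -/
theorem eq_zero_of_inner_cross3 {u v z : Space3} (h : cross3 u v ≠ 0) (hu : inner ℝ z u = 0)
    (hv : inner ℝ z v = 0) (hw : inner ℝ z (cross3 u v) = 0) : z = 0 := by
  rw [← alignVec_self h z, alignVec, hu, hv, hw]; simp

theorem alignVec_left {u v : Space3} (h : cross3 u v ≠ 0) (σ : ℝ) (u' v' : Space3) :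
    alignVec σ u v u' v' u = u' := by
  rw [alignVec, inv_smul_eq_iff₀ (inner_cross3_self_ne_zero h), inner_left_cross3,
    inner_cross3_self]
  module

theorem alignVec_right {u v : Space3} (h : cross3 u v ≠ 0) (σ : ℝ) (u' v' : Space3) :
    alignVec σ u v u' v' v = v' := by
  rw [alignVec, inv_smul_eq_iff₀ (inner_cross3_self_ne_zero h), inner_right_cross3,
    inner_cross3_self, real_inner_comm u v]
  module

theorem alignVec_cross3 {u v : Space3} (h : cross3 u v ≠ 0) (σ : ℝ) (u' v' : Space3) :
    alignVec σ u v u' v' (cross3 u v) = σ • cross3 u' v' := by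
  rw [alignVec, inv_smul_eq_iff₀ (inner_cross3_self_ne_zero h), real_inner_comm u (cross3 u v),
    inner_left_cross3, real_inner_comm v (cross3 u v), inner_right_cross3]
  module

/-- `alignVec` as a linear map. -/
noncomputable def alignLin (σ : ℝ) (u v u' v' : Space3) : Space3 →ₗ[ℝ] Space3 where
  toFun := alignVec σ u v u' v'
  map_add' x y := by simp only [alignVec, inner_add_left]; module
  map_smul' c x := by simp only [alignVec, real_inner_smul_left, RingHom.id_apply]; module

/-- The norm of a combination of `x`, `y`, `cross3 x y` depends only on its coefficients and on the
Gram matrix of `x` and `y`; the sign enters squared. -/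
theorem inner_alignVec_self {σ : ℝ} (hσ : σ ^ 2 = 1) {u v u' v' : Space3} (h : cross3 u v ≠ 0)
    (huu : inner ℝ u' u' = inner ℝ u u) (huv : inner ℝ u' v' = inner ℝ u v)
    (hvv : inner ℝ v' v' = inner ℝ v v) (z : Space3) :
    inner ℝ (alignVec σ u v u' v' z) (alignVec σ u v u' v' z) = inner ℝ z z := by
  have key : ∀ (τ : ℝ), τ ^ 2 = 1 → ∀ x y : Space3, ∀ a b c : ℝ,
      inner ℝ (a • x + b • y + (τ * c) • cross3 x y) (a • x + b • y + (τ * c) • cross3 x y) =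
      a ^ 2 * inner ℝ x x + 2 * a * b * inner ℝ x y + b ^ 2 * inner ℝ y y +
        c ^ 2 * (inner ℝ x x * inner ℝ y y - inner ℝ x y ^ 2) := by
    intro τ hτ x y a b c
    simp only [inner_add_left, inner_add_right, real_inner_smul_left, real_inner_smul_right,
      inner_left_cross3, inner_right_cross3, inner_cross3_self, real_inner_comm x (cross3 x y),
      real_inner_comm y (cross3 x y), real_inner_comm x y]
    linear_combination c ^ 2 * (inner ℝ x x * inner ℝ y y - inner ℝ x y ^ 2) * hτ
  conv_rhs => rw [← alignVec_self h z]
  simp only [alignVec, real_inner_smul_left, real_inner_smul_right]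
  rw [key σ hσ, key 1 (by norm_num), huu, huv, hvv]

/-- Linear isometries map cross products to cross products, up to the sign of the determinant. -/
theorem cross3_map (L : Space3 ≃ₗᵢ[ℝ] Space3) (u v : Space3) :
    cross3 (L u) (L v) =
      LinearMap.det (L.toLinearEquiv : Space3 →ₗ[ℝ] Space3) • L (cross3 u v) := by
  have hdet : ∀ z, inner ℝ (L z) (cross3 (L u) (L v)) =
      LinearMap.det (L.toLinearEquiv : Space3 →ₗ[ℝ] Space3) * inner ℝ z (cross3 u v) := by
    intro z
    let b := (EuclideanSpace.basisFun (Fin 3) ℝ).toBasis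
    rw [inner_cross3_eq_det, inner_cross3_eq_det, ← LinearMap.det_toMatrix b, ← Matrix.det_mul]
    congr 1
    have hL : ∀ (x : Space3) (i : Fin 3), (L x).ofLp i =
        ∑ j, LinearMap.toMatrix b b (L.toLinearEquiv : Space3 →ₗ[ℝ] Space3) i j * x.ofLp j := by
      intro x i
      have := congrFun (LinearMap.toMatrix_mulVec_repr b b
        (L.toLinearEquiv : Space3 →ₗ[ℝ] Space3) x) i
      simpa [b, Matrix.mulVec, dotProduct] using this.symm
    ext i j
    rw [Matrix.mul_apply]
    fin_cases j <;> simp [hL]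
  refine ext_inner_left ℝ fun x => ?_
  obtain ⟨z, rfl⟩ := L.surjective x
  rw [hdet, real_inner_smul_right, L.inner_map_map]

/-- The determinant of the linear part of an isometry. -/
noncomputable def isometryDet (g : Space3 ≃ᵃⁱ[ℝ] Space3) : ℝ :=
  LinearMap.det (g.linearIsometryEquiv.toLinearEquiv : Space3 →ₗ[ℝ] Space3)

theorem isometryDet_trans (f g : Space3 ≃ᵃⁱ[ℝ] Space3) :
    isometryDet (f.trans g) = isometryDet f * isometryDet g := by
  unfold isometryDet
  rw [mul_comm, ← LinearMap.det_comp]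
  rfl

theorem affineIsometry_sub (g : Space3 ≃ᵃⁱ[ℝ] Space3) (x y : Space3) :
    g x - g y = g.linearIsometryEquiv (x - y) := by
  simpa using (g.map_vsub x y).symm

/-- Isometries with the same orientation that agree on a triangle are equal. -/
theorem affineIsometry_eq_of_triangle {f g : Space3 ≃ᵃⁱ[ℝ] Space3}
    (hdet : isometryDet f = isometryDet g) {a a' b : Space3} (h : cross3 (a' - a) (b - a) ≠ 0)
    (ha : f a = g a) (ha' : f a' = g a') (hb : f b = g b) (z : Space3) : f z = g z := by
  set F := f.linearIsometryEquiv
  set G := g.linearIsometryEquiv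
  set u := a' - a
  set v := b - a
  have hu : F u = G u := by rw [← affineIsometry_sub, ← affineIsometry_sub, ha, ha']
  have hv : F v = G v := by rw [← affineIsometry_sub, ← affineIsometry_sub, ha, hb]
  -- Equal determinants extend the agreement on `u` and `v` to the third basis vector.
  have hw : F (cross3 u v) = G (cross3 u v) := by
    have h1 := cross3_map F u v
    rw [hu, hv, cross3_map G u v] at h1
    have hd : LinearMap.det (G.toLinearEquiv : Space3 →ₗ[ℝ] Space3) ≠ 0 :=
      (LinearEquiv.isUnit_det' G.toLinearEquiv).ne_zero
    have h2 : LinearMap.det (F.toLinearEquiv : Space3 →ₗ[ℝ] Space3) =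
      LinearMap.det (G.toLinearEquiv : Space3 →ₗ[ℝ] Space3) := hdet
    rw [h2] at h1
    exact (smul_right_injective _ hd h1).symm
  have hz : F (z - a) = G (z - a) := by
    rw [← alignVec_self h (z - a), alignVec]
    simp only [map_smul, map_add]
    rw [hu, hv, hw]
  have := affineIsometry_sub f z a
  have h2 := affineIsometry_sub g z a
  change f z - f a = F (z - a) at this
  change g z - g a = G (z - a) at h2
  rw [hz, ← h2, ha] at this
  exact sub_left_injective this

/-- The map that carries a triangle with vertices `x` to a congruent triangle with vertices `y`,
preserving or reversing the orientation according to the sign `σ`. -/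
noncomputable def alignPoint (σ : ℝ) (x y : Fin 3 → Space3) (z : Space3) : Space3 :=
  y 0 + alignVec σ (x 1 - x 0) (x 2 - x 0) (y 1 - y 0) (y 2 - y 0) (z - x 0)

theorem inner_sub_sub_eq (a b c : Space3) :
    inner ℝ (b - a) (c - a) = (dist b a ^ 2 + dist c a ^ 2 - dist b c ^ 2) / 2 := by
  have h : b - c = (b - a) - (c - a) := by abel
  have h' := norm_sub_sq_real (b - a) (c - a)
  rw [← h] at h'
  simp only [dist_eq_norm, h']
  ring

theorem inner_triangle_eq {x y : Fin 3 → Space3} (h : ∀ i j, dist (y i) (y j) = dist (x i) (x j))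
    (i j k : Fin 3) :
    inner ℝ (y i - y k) (y j - y k) = inner ℝ (x i - x k) (x j - x k) := by
  simp only [inner_sub_sub_eq, h]

/-- The squared norm of the cross product is a Gram determinant, hence a function of the three side
lengths. -/
theorem cross3_ne_zero_of_congruent {x y : Fin 3 → Space3}
    (h : ∀ i j, dist (y i) (y j) = dist (x i) (x j))
    (hx : cross3 (x 1 - x 0) (x 2 - x 0) ≠ 0) : cross3 (y 1 - y 0) (y 2 - y 0) ≠ 0 := by
  intro h0
  apply inner_cross3_self_ne_zero hx
  rw [inner_cross3_self, ← inner_triangle_eq h, ← inner_triangle_eq h, ← inner_triangle_eq h,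
    ← inner_cross3_self, h0, inner_zero_left]

/-- Congruent triangles are aligned by an isometry with prescribed orientation. -/
theorem exists_isometry_eq_alignPoint {σ : ℝ} (hσ : σ ^ 2 = 1) {x y : Fin 3 → Space3}
    (h : ∀ i j, dist (y i) (y j) = dist (x i) (x j))
    (hx : cross3 (x 1 - x 0) (x 2 - x 0) ≠ 0) :
    ∃ g : Space3 ≃ᵃⁱ[ℝ] Space3, isometryDet g = σ ∧ (∀ z, g z = alignPoint σ x y z) ∧
      ∀ i, g (x i) = y i := by
  let li : Space3 →ₗᵢ[ℝ] Space3 :=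
    { toLinearMap := alignLin σ (x 1 - x 0) (x 2 - x 0) (y 1 - y 0) (y 2 - y 0)
      norm_map' := fun z => by
        have := inner_alignVec_self hσ hx (inner_triangle_eq h 1 1 0) (inner_triangle_eq h 1 2 0)
          (inner_triangle_eq h 2 2 0) z
        rw [real_inner_self_eq_norm_sq, real_inner_self_eq_norm_sq] at this
        exact (sq_eq_sq₀ (norm_nonneg _) (norm_nonneg _)).1 this }
  let L : Space3 ≃ₗᵢ[ℝ] Space3 := li.toLinearIsometryEquiv rfl
  have hL : ∀ z, L z = alignVec σ (x 1 - x 0) (x 2 - x 0) (y 1 - y 0) (y 2 - y 0) z := fun z => rfl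
  let g : Space3 ≃ᵃⁱ[ℝ] Space3 :=
    AffineIsometryEquiv.mk' (fun z => alignPoint σ x y z) L (x 0) fun z => by
      change y 0 + L (z - x 0) = L (z - x 0) + (y 0 + L (x 0 - x 0))
      rw [sub_self, map_zero, add_zero, add_comm]
  have hg : ∀ z, g z = alignPoint σ x y z := fun z => rfl
  refine ⟨g, ?_, hg, fun i => ?_⟩
  · have h1 := cross3_map L (x 1 - x 0) (x 2 - x 0)
    rw [hL, hL, hL, alignVec_left hx, alignVec_right hx, alignVec_cross3 hx, smul_smul] at h1
    have h2 := cross3_ne_zero_of_congruent h hx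
    -- The image of the cross product is known both from the formula and from the determinant;
    -- comparing the two identifies the determinant as `σ`.
    have h3 : (1 : ℝ) = LinearMap.det (L.toLinearEquiv : Space3 →ₗ[ℝ] Space3) * σ :=
      smul_left_injective ℝ h2 (by simpa using h1)
    have h4 : isometryDet g = LinearMap.det (L.toLinearEquiv : Space3 →ₗ[ℝ] Space3) := rfl
    rw [h4]
    linear_combination -σ * h3 - LinearMap.det (L.toLinearEquiv : Space3 →ₗ[ℝ] Space3) * hσ
  · rw [hg, alignPoint]
    fin_cases i
    · simp [alignVec]
    · simp [alignVec_left hx]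
    · simp [alignVec_right hx]

theorem continuousWithinAt_alignVec {X : Type*} [TopologicalSpace X] (σ : ℝ)
    {u v u' v' z : X → Space3} {s : Set X} {t : X} (hu : ContinuousWithinAt u s t)
    (hv : ContinuousWithinAt v s t) (hu' : ContinuousWithinAt u' s t)
    (hv' : ContinuousWithinAt v' s t) (hz : ContinuousWithinAt z s t)
    (h : cross3 (u t) (v t) ≠ 0) :
    ContinuousWithinAt (fun r => alignVec σ (u r) (v r) (u' r) (v' r) (z r)) s t := by
  have hc : ∀ {k l : X → Space3}, ContinuousWithinAt k s t → ContinuousWithinAt l s t →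
      ContinuousWithinAt (fun r => cross3 (k r) (l r)) s t := fun hk hl =>
    continuous_cross3.continuousAt.comp_continuousWithinAt (hk.prodMk hl)
  have hi : ∀ {k l : X → Space3}, ContinuousWithinAt k s t → ContinuousWithinAt l s t →
      ContinuousWithinAt (fun r => inner ℝ (k r) (l r)) s t := fun hk hl => hk.inner hl
  have h0 := (hi (hc hu hv) (hc hu hv)).inv₀ (inner_cross3_self_ne_zero h)
  have h1 := (((hi hv hv).mul (hi hz hu)).sub ((hi hu hv).mul (hi hz hv))).smul hu'
  have h2 := (((hi hu hu).mul (hi hz hv)).sub ((hi hu hv).mul (hi hz hu))).smul hv'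
  have h3 := ((hi hz (hc hu hv)).const_mul σ).smul (hc hu' hv')
  simp only [alignVec]
  exact h0.smul ((h1.add h2).add h3)

theorem continuousWithinAt_alignPoint {X : Type*} [TopologicalSpace X] (σ : ℝ)
    {x y : X → Fin 3 → Space3} {z : X → Space3} {s : Set X} {t : X}
    (hx : ContinuousWithinAt x s t) (hy : ContinuousWithinAt y s t)
    (hz : ContinuousWithinAt z s t)
    (h : cross3 (x t 1 - x t 0) (x t 2 - x t 0) ≠ 0) :
    ContinuousWithinAt (fun r => alignPoint σ (x r) (y r) (z r)) s t := by
  have hx' : ∀ i, ContinuousWithinAt (fun r => x r i) s t := continuousWithinAt_pi.1 hx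
  have hy' : ∀ i, ContinuousWithinAt (fun r => y r i) s t := continuousWithinAt_pi.1 hy
  have h1 := continuousWithinAt_alignVec σ (u := fun r => x r 1 - x r 0)
    (v := fun r => x r 2 - x r 0) (u' := fun r => y r 1 - y r 0) (v' := fun r => y r 2 - y r 0)
    (z := fun r => z r - x r 0) ((hx' 1).sub (hx' 0)) ((hx' 2).sub (hx' 0))
    ((hy' 1).sub (hy' 0)) ((hy' 2).sub (hy' 0)) (hz.sub (hx' 0)) h
  exact (hy' 0).add h1

/-- An orientation-reversing isometry that fixes `a` and `a'` and maps `b` to `b'` swaps `b` and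
`b'`. -/
theorem affineIsometry_swap {g : Space3 ≃ᵃⁱ[ℝ] Space3} (hg : isometryDet g = -1)
    {a a' b b' : Space3} (h : cross3 (a' - a) (b - a) ≠ 0) (ha : g a = a) (ha' : g a' = a')
    (hb : g b = b') : g b' = b := by
  set L := g.linearIsometryEquiv
  have hu : L (a' - a) = a' - a := by rw [← affineIsometry_sub, ha, ha']
  have hv : L (b - a) = b' - a := by rw [← affineIsometry_sub, ha, hb]
  have hdet : LinearMap.det (L.toLinearEquiv : Space3 →ₗ[ℝ] Space3) = -1 := hg
  have hw : cross3 (a' - a) (b' - a) = -L (cross3 (a' - a) (b - a)) := by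
    have := cross3_map L (a' - a) (b - a)
    rwa [hu, hv, hdet, neg_one_smul] at this
  have hne : cross3 (a' - a) (b' - a) ≠ 0 := by
    rw [hw, neg_ne_zero]
    exact fun h0 => h (by simpa using h0)
  -- The isometry fixes the line `aa'` and reverses orientation, so it is a plane reflection and an
  -- involution. This is checked against the basis `a' - a`, `b' - a` and their cross product.
  have hx : L (b' - a) - (b - a) = 0 := by
    refine eq_zero_of_inner_cross3 hne ?_ ?_ ?_
    · have h1 : inner ℝ (b' - a) (a' - a) = inner ℝ (b - a) (a' - a) := by
        rw [← hv]; nth_rw 1 [← hu]; exact L.inner_map_map _ _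
      have h2 : inner ℝ (L (b' - a)) (a' - a) = inner ℝ (b' - a) (a' - a) := by
        nth_rw 1 [← hu]; exact L.inner_map_map _ _
      rw [inner_sub_left, h2, h1, sub_self]
    · have h2 : inner ℝ (L (b' - a)) (b' - a) = inner ℝ (b' - a) (b - a) := by
        rw [← hv, L.inner_map_map, hv]
      rw [inner_sub_left, h2, real_inner_comm, sub_self]
    · have h2 : inner ℝ (L (b' - a)) (cross3 (a' - a) (b' - a)) =
          -inner ℝ (b' - a) (cross3 (a' - a) (b - a)) := by
        rw [hw, inner_neg_right, L.inner_map_map]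
      rw [inner_sub_left, h2, inner_cross3_swap (b - a), sub_self]
  have h3 := affineIsometry_sub g b' a
  change g b' - g a = L (b' - a) at h3
  rw [ha, sub_eq_zero.1 hx] at h3
  exact sub_left_injective h3

/-! ### The flex of an isostatic framework with one bar removed -/

theorem isometryDet_symm {g : Space3 ≃ᵃⁱ[ℝ] Space3} (h : isometryDet g = 1) :
    isometryDet g.symm = 1 := by
  have h1 := isometryDet_trans g g.symm
  rw [g.self_trans_symm, h, one_mul] at h1
  rw [← h1]
  exact LinearMap.det_id

/-! ### Independent functionals -/

section LinearAlgebra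

/-- Linearly independent functionals can be given arbitrary values simultaneously. -/
theorem LinearIndependent.pi_surjective {ι E : Type*} [Fintype ι] [AddCommGroup E] [Module ℝ E]
    {f : ι → E →ₗ[ℝ] ℝ} (hf : LinearIndependent ℝ f) :
    Function.Surjective (LinearMap.pi f) := by
  classical
  rw [← LinearMap.range_eq_top]
  by_contra hne
  -- A nonzero functional vanishing on the range has as coefficients a linear relation among the `f
  -- i`.
  obtain ⟨φ, hφ, hle⟩ := Submodule.exists_le_ker_of_lt_top _ (lt_top_iff_ne_top.2 hne)
  refine hφ ((Pi.basisFun ℝ ι).ext fun i => ?_)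
  have hsum : ∑ i, φ (Pi.single i 1) • f i = 0 := by
    refine LinearMap.ext fun x => ?_
    have hx : φ (LinearMap.pi f x) = 0 := hle ⟨x, rfl⟩
    rw [LinearMap.pi_apply_eq_sum_univ φ] at hx
    have hs : ∀ i : ι, (fun j => if i = j then (1 : ℝ) else 0) = Pi.single i 1 := fun i => by
      ext j
      simp [Pi.single_apply, eq_comm]
    simpa [mul_comm, LinearMap.sum_apply, hs] using hx
  simpa using Fintype.linearIndependent_iff.1 hf _ hsum i

end LinearAlgebra

/-! ### Consequences of strict differentiability -/

section Calculus

variable {E F : Type*} [NormedAddCommGroup E] [NormedSpace ℝ E]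
  [NormedAddCommGroup F] [NormedSpace ℝ F]

/-- A map with surjective strict derivative attains a segment of values along a continuous curve. -/
theorem HasStrictFDerivAt.exists_curve [FiniteDimensional ℝ F] {f : E → F} {f' : E →L[ℝ] F} {p : E}
    (hf : HasStrictFDerivAt f f' p) (hs : Function.Surjective f') (w : F) :
    ∃ (ε : ℝ) (γ : ℝ → E), 0 < ε ∧ ContinuousOn γ (Ioo (-ε) ε) ∧ γ 0 = p ∧
      ∀ t ∈ Ioo (-ε) ε, f (γ t) = f p + t • w := by
  -- On the slice `p + R y` the map has the identity as derivative, so the inverse function theorem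
  -- lifts the segment of values.
  obtain ⟨R, hR⟩ := (f' : E →ₗ[ℝ] F).exists_rightInverse_of_surjective (LinearMap.range_eq_top.2 hs)
  let R' : F →L[ℝ] E := LinearMap.toContinuousLinearMap R
  have hfR : f'.comp R' = (ContinuousLinearEquiv.refl ℝ F : F →L[ℝ] F) := by
    ext y
    exact LinearMap.congr_fun hR y
  have hg : HasStrictFDerivAt (fun y => p + R' y) R' 0 := R'.hasStrictFDerivAt.const_add p
  have hH : HasStrictFDerivAt (fun y => f (p + R' y))
      (ContinuousLinearEquiv.refl ℝ F : F →L[ℝ] F) 0 := by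
    rw [← hfR]
    refine HasStrictFDerivAt.comp (g := f) 0 ?_ hg
    simpa using hf
  let Φ := hH.toOpenPartialHomeomorph _
  have hΦ : ∀ y, Φ y = f (p + R' y) := fun y => rfl
  have h0s : (0 : F) ∈ Φ.source := hH.mem_toOpenPartialHomeomorph_source
  have h0 : Φ 0 = f p := by simp [hΦ]
  have hmem : {t : ℝ | f p + t • w ∈ Φ.target} ∈ 𝓝 (0 : ℝ) := by
    have hc : Continuous fun t : ℝ => f p + t • w := by fun_prop
    refine (Φ.open_target.preimage hc).mem_nhds ?_
    simpa [← h0] using Φ.map_source h0s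
  obtain ⟨ε, hε, hball⟩ := Metric.mem_nhds_iff.1 hmem
  rw [Real.ball_eq_Ioo, zero_sub, zero_add] at hball
  refine ⟨ε, fun t => p + R' (Φ.symm (f p + t • w)), hε, ?_, ?_, fun t ht => ?_⟩
  · refine continuousOn_const.add (R'.continuous.comp_continuousOn ?_)
    exact Φ.continuousOn_symm.comp (by fun_prop) hball
  · simp [← h0, Φ.left_inv h0s]
  · rw [← hΦ, Φ.right_inv (hball ht)]

/-- A map with injective strict derivative is injective near the point. -/
theorem HasStrictFDerivAt.exists_injOn [FiniteDimensional ℝ E] {f : E → F} {f' : E →L[ℝ] F} {p : E}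
    (hf : HasStrictFDerivAt f f' p) (hi : Function.Injective f') :
    ∃ N ∈ 𝓝 p, Set.InjOn f N := by
  obtain ⟨K, hK, hanti⟩ := (f' : E →ₗ[ℝ] F).injective_iff_antilipschitz.1 hi
  -- The derivative shrinks distances at most by the factor `K⁻¹`. An approximation error of half
  -- that size gives `‖x - y‖ ≤ ‖x - y‖ / 2` whenever the values at `x` and `y` coincide.
  have hc : (0 : NNReal) < K⁻¹ / 2 := by positivity
  obtain ⟨N, hN, happ⟩ := hf.approximates_deriv_on_nhds (Or.inr hc)
  refine ⟨N, hN, fun x hx y hy hxy => ?_⟩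
  have h1 := happ x hx y hy
  rw [hxy, sub_self, zero_sub, norm_neg] at h1
  have h2 := hanti.le_mul_dist x y
  rw [dist_eq_norm, dist_eq_norm, ← map_sub] at h2
  have hK' : (0 : ℝ) < K := hK
  have h3 : ‖x - y‖ ≤ K * ((K⁻¹ / 2 : NNReal) * ‖x - y‖) :=
    h2.trans (mul_le_mul_of_nonneg_left h1 hK'.le)
  have h4 : (K : ℝ) * ((K⁻¹ / 2 : NNReal) * ‖x - y‖) = ‖x - y‖ / 2 := by
    push_cast
    field_simp
  rw [h4] at h3
  have h5 : ‖x - y‖ ≤ 0 := by linarith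
  exact sub_eq_zero.1 (norm_le_zero_iff.1 h5)

end Calculus

/-! ### Bar lengths near an isostatic framework -/

section Frameworks

variable {V : Type*}

/-- The squared lengths of the bars. -/
noncomputable def lenSq (q : V → Space3) : Sym2 V → ℝ :=
  Sym2.lift ⟨fun i j => ‖q i - q j‖ ^ 2, fun _ _ => congrArg (· ^ 2) (norm_sub_rev _ _)⟩

theorem lenSq_mk (q : V → Space3) (i j : V) : lenSq q s(i, j) = dist (q i) (q j) ^ 2 := by
  rw [dist_eq_norm]; rfl

/-- Links the rigidity matrix to calculus: up to the factor 2 it is the derivative of the squared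
lengths. -/
theorem hasStrictFDerivAt_lenSq [Fintype V] (p : V → Space3) (e : Sym2 V) :
    HasStrictFDerivAt (fun q => lenSq q e)
      (LinearMap.toContinuousLinearMap ((2 : ℝ) • rigidityRow p e)) p := by
  induction e with
  | h i j =>
    have h1 : HasStrictFDerivAt (fun q : V → Space3 => q i - q j)
        (ContinuousLinearMap.proj (R := ℝ) (φ := fun _ : V => Space3) i -
          ContinuousLinearMap.proj (R := ℝ) (φ := fun _ : V => Space3) j) p :=
      (ContinuousLinearMap.proj (R := ℝ) (φ := fun _ : V => Space3) i -
        ContinuousLinearMap.proj (R := ℝ) (φ := fun _ : V => Space3) j).hasStrictFDerivAt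
    have h2 := (hasStrictFDerivAt_norm_sq (p i - p j)).comp p h1
    refine h2.congr_fderiv (ContinuousLinearMap.ext fun u => ?_)
    simp [rigidityRow, barRow_apply, inner_sub_left, inner_sub_right]
    ring

theorem RigidlyEquivalent.dist_eq {p q : V → Space3} (h : RigidlyEquivalent p q) (i j : V) :
    dist (q i) (q j) = dist (p i) (p j) := by
  obtain ⟨g, -, hg⟩ := h
  rw [hg, hg, g.dist_map]

/-- The triangles of a framework with independent bars are not degenerate. -/
theorem cross3_ne_zero_of_linearIndependent {G : SimpleGraph V} {p : V → Space3}
    (h : LinearIndependent ℝ (fun e : G.edgeSet => rigidityRow p e)) {a a' b : V}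
    (haa' : G.Adj a a') (hab : G.Adj a b) (ha'b : G.Adj a' b) :
    cross3 (p a' - p a) (p b - p a) ≠ 0 := by
  intro h0
  let e : Fin 3 → G.edgeSet := ![⟨s(a, a'), haa'⟩, ⟨s(a, b), hab⟩, ⟨s(a', b), ha'b⟩]
  have hinj : Function.Injective e := by
    intro i j hij
    have hij' : ![s(a, a'), s(a, b), s(a', b)] i = ![s(a, a'), s(a, b), s(a', b)] j := by
      have := congrArg Subtype.val hij
      fin_cases i <;> fin_cases j <;> exact this
    have h1 := haa'.ne
    have h2 := hab.ne
    have h3 := ha'b.ne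
    have h1' := haa'.ne'
    have h2' := hab.ne'
    clear hij
    fin_cases i <;> fin_cases j <;> simp_all
  have hli : LinearIndependent ℝ ![barRow p a a', barRow p a b, barRow p a' b] := by
    convert h.comp e hinj using 1
    funext i
    fin_cases i <;> rfl
  have hne01 : p a ≠ p a' := fun h01 =>
    hli.ne_zero 0 (LinearMap.ext fun u => by simp [barRow_apply, h01])
  have hne02 : p a ≠ p b := fun h01 =>
    hli.ne_zero 1 (LinearMap.ext fun u => by simp [barRow_apply, h01])
  obtain ⟨c, hc⟩ : ∃ c : ℝ, p b - p a = c • (p a' - p a) := by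
    have h1 := cross3_cross3_left (p a' - p a) (p b - p a)
    rw [h0, zero_cross3, eq_comm, sub_eq_zero] at h1
    have h2 : inner ℝ (p a' - p a) (p a' - p a) ≠ 0 := fun h3 =>
      hne01 (sub_eq_zero.1 (inner_self_eq_zero.1 h3)).symm
    refine ⟨(inner ℝ (p a' - p a) (p a' - p a))⁻¹ * inner ℝ (p a' - p a) (p b - p a), ?_⟩
    rw [mul_smul, ← h1, inv_smul_smul₀ h2]
  have hb : p b = p a + c • (p a' - p a) := by rw [← hc]; abel
  have hc0 : c ≠ 0 := by
    rintro rfl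
    exact hne02 (by simpa using hb.symm)
  -- The self-stress of a collinear triangle. The bar vectors are `-1`, `-c` and `1 - c` times `p a'
  -- - p a`, so the weighted bars are all `± c * (c - 1)` times it and the velocity differences
  -- cancel around the triangle. The last coefficient is the one known to be nonzero.
  have hrel := Fintype.linearIndependent_iff.1 hli ![c * (c - 1), -(c - 1), c] (by
    refine LinearMap.ext fun u => ?_
    simp only [LinearMap.add_apply, LinearMap.smul_apply, barRow_apply, Fin.sum_univ_three,
      Matrix.cons_val, smul_eq_mul, LinearMap.zero_apply]
    have e1 : p a - p a' = -(p a' - p a) := by abel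
    have e2 : p a - p b = -(c • (p a' - p a)) := by rw [hb]; abel
    have e3 : p a' - p b = (1 - c) • (p a' - p a) := by rw [hb]; module
    rw [e1, e2, e3]
    simp only [inner_neg_left, real_inner_smul_left, inner_sub_right]
    ring) 2
  exact hc0 (by simpa using hrel)

/-- A trivial motion that fixes the vertices of a nondegenerate triangle vanishes. -/
theorem IsTrivialMotion.eq_zero {p u : V → Space3} (hu : IsTrivialMotion p u) {a a' b : V}
    (h : cross3 (p a' - p a) (p b - p a) ≠ 0) (ha : u a = 0) (ha' : u a' = 0) (hb : u b = 0) :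
    u = 0 := by
  obtain ⟨S, c, hS, hSu⟩ := hu
  have h1 : S (p a' - p a) = 0 := by
    have : S (p a' - p a) = u a' - u a := by rw [hSu, hSu, map_sub]; abel
    rw [this, ha, ha', sub_zero]
  have h2 : S (p b - p a) = 0 := by
    have : S (p b - p a) = u b - u a := by rw [hSu, hSu, map_sub]; abel
    rw [this, ha, hb, sub_zero]
  -- By skew-symmetry this image is orthogonal to the two sides, which `S` kills, and to the cross
  -- product itself. Then every `S z` is orthogonal to all three basis vectors.
  have h3 : S (cross3 (p a' - p a) (p b - p a)) = 0 := by
    refine eq_zero_of_inner_cross3 h ?_ ?_ ?_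
    · rw [hS, h1, inner_zero_right, neg_zero]
    · rw [hS, h2, inner_zero_right, neg_zero]
    · have := hS (cross3 (p a' - p a) (p b - p a)) (cross3 (p a' - p a) (p b - p a))
      rw [real_inner_comm] at this ⊢
      linarith
  have h4 : ∀ z, S z = 0 := fun z =>
    eq_zero_of_inner_cross3 h (by rw [hS, h1, inner_zero_right, neg_zero])
      (by rw [hS, h2, inner_zero_right, neg_zero]) (by rw [hS, h3, inner_zero_right, neg_zero])
  funext v
  have hc := hSu a
  rw [ha, h4, zero_add] at hc
  rw [hSu, h4, ← hc, add_zero, Pi.zero_apply]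

variable [Fintype V] {G : SimpleGraph V} {p : V → Space3} {a a' b : V}

/-- Near an infinitesimally rigid framework, the bar lengths determine the placement once a
triangle is pinned down. -/
theorem exists_nhds_eq_of_lenSq_eq (h : ∀ u, IsInfinitesimalMotion G p u → IsTrivialMotion p u)
    (hne : cross3 (p a' - p a) (p b - p a) ≠ 0) :
    ∃ N ∈ 𝓝 p, ∀ x ∈ N, ∀ y ∈ N, (∀ e : G.edgeSet, lenSq x e = lenSq y e) →
      x a = y a → x a' = y a' → x b = y b → x = y := by
  let _ : Fintype G.edgeSet := Fintype.ofFinite _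
  let pr (v : V) := ContinuousLinearMap.proj (R := ℝ) (φ := fun _ : V => Space3) v
  have h1 : HasStrictFDerivAt (fun (q : V → Space3) (e : G.edgeSet) => lenSq q e)
      (ContinuousLinearMap.pi fun e : G.edgeSet =>
        LinearMap.toContinuousLinearMap ((2 : ℝ) • rigidityRow p e)) p :=
    hasStrictFDerivAt_pi.2 fun e => hasStrictFDerivAt_lenSq p e
  -- The lengths are supplemented by the positions of the triangle. A kernel vector of the
  -- derivative is then an infinitesimal motion at rest on the triangle, so it is trivial and hence
  -- zero.
  have h2 := h1.prodMk (((pr a).hasStrictFDerivAt (x := p)).prodMk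
    (((pr a').hasStrictFDerivAt (x := p)).prodMk ((pr b).hasStrictFDerivAt (x := p))))
  obtain ⟨N, hN, hinj⟩ := h2.exists_injOn (by
    rw [injective_iff_map_eq_zero]
    intro u hu
    simp only [ContinuousLinearMap.prod_apply, Prod.mk_eq_zero] at hu
    obtain ⟨hlen, ha, ha', hb⟩ := hu
    refine (h u fun i j hij => ?_).eq_zero hne ha ha' hb
    have := congrFun hlen ⟨s(i, j), hij⟩
    simpa [rigidityRow, barRow_apply] using this)
  refine ⟨N, hN, fun x hx y hy hxy ha ha' hb => hinj hx hy ?_⟩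
  exact Prod.ext (funext hxy) (Prod.ext ha (Prod.ext ha' hb))

/-- An isostatic framework from which the bar `aa'` of a triangle `aa'b` is removed has a single
flex, which can be parametrized by the squared distance of `a` and `a'`. -/
theorem IsIsostaticFramework.exists_flex (h : IsIsostaticFramework G p)
    (haa' : G.Adj a a') (hab : G.Adj a b) (ha'b : G.Adj a' b) :
    ∃ (ε : ℝ) (γ : ℝ → V → Space3), 0 < ε ∧ ContinuousOn γ (Ioo (-ε) ε) ∧ γ 0 = p ∧
      (∀ t ∈ Ioo (-ε) ε, SameBarLengths (G.deleteEdges {s(a, a')}) p (γ t)) ∧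
      (∀ t ∈ Ioo (-ε) ε, dist (γ t a) (γ t a') ^ 2 = dist (p a) (p a') ^ 2 + t) ∧
      (∀ t ∈ Ioo (-ε) ε, cross3 (γ t a' - γ t a) (γ t b - γ t a) ≠ 0) ∧
      ∃ U ∈ 𝓝 p, ∀ q ∈ U, SameBarLengths (G.deleteEdges {s(a, a')}) p q →
        ∃ t ∈ Ioo (-ε) ε, RigidlyEquivalent (γ t) q := by
  classical
  let _ : Fintype G.edgeSet := Fintype.ofFinite _
  have hne := cross3_ne_zero_of_linearIndependent h.2 haa' hab ha'b
  have hF : HasStrictFDerivAt (fun (q : V → Space3) (e : G.edgeSet) => lenSq q e)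
      (ContinuousLinearMap.pi fun e : G.edgeSet =>
        LinearMap.toContinuousLinearMap ((2 : ℝ) • rigidityRow p e)) p :=
    hasStrictFDerivAt_pi.2 fun e => hasStrictFDerivAt_lenSq p e
  have hsurj : Function.Surjective (ContinuousLinearMap.pi fun e : G.edgeSet =>
      LinearMap.toContinuousLinearMap ((2 : ℝ) • rigidityRow p e)) := by
    intro y
    obtain ⟨u, hu⟩ := h.2.pi_surjective ((2 : ℝ)⁻¹ • y)
    refine ⟨u, funext fun e => ?_⟩
    have := congrFun hu e
    simp only [LinearMap.pi_apply, Pi.smul_apply, smul_eq_mul] at this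
    simp [this]
  -- In this direction only the squared length of `aa'` changes, at unit rate.
  let w : G.edgeSet → ℝ := Pi.single ⟨s(a, a'), haa'⟩ 1
  obtain ⟨ε₀, γ, hε₀, hγc, hγ0, hγ⟩ := hF.exists_curve hsurj w
  have hγat : ContinuousAt γ 0 := hγc.continuousAt (Ioo_mem_nhds (by linarith) hε₀)
  have hcr : Continuous fun q : V → Space3 => cross3 (q a' - q a) (q b - q a) :=
    continuous_cross3.comp (by fun_prop : Continuous fun q : V → Space3 => (q a' - q a, q b - q a))
  have hev : ∀ᶠ t in 𝓝 (0 : ℝ), t ∈ Ioo (-ε₀) ε₀ ∧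
      cross3 (γ t a' - γ t a) (γ t b - γ t a) ≠ 0 := by
    have hIoo : ∀ᶠ t in 𝓝 (0 : ℝ), t ∈ Ioo (-ε₀) ε₀ := Ioo_mem_nhds (by linarith) hε₀
    refine hIoo.and ?_
    have := (hcr.continuousAt (x := γ 0)).comp hγat
    exact this.eventually_ne (by simpa [hγ0] using hne)
  obtain ⟨ε, hε, hball⟩ := Metric.mem_nhds_iff.1 hev
  rw [Real.ball_eq_Ioo, zero_sub, zero_add] at hball
  have hbar : ∀ t ∈ Ioo (-ε) ε, SameBarLengths (G.deleteEdges {s(a, a')}) p (γ t) := by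
    intro t ht i j hij
    rw [SimpleGraph.deleteEdges_adj, mem_singleton_iff] at hij
    have := congrFun (hγ t (hball ht).1) ⟨s(i, j), hij.1⟩
    simp only [Pi.add_apply, Pi.smul_apply, lenSq_mk, w] at this
    rw [Pi.single_eq_of_ne (fun he => hij.2 (congrArg Subtype.val he)), smul_zero, add_zero] at this
    exact (sq_eq_sq₀ dist_nonneg dist_nonneg).1 this
  have hdiag : ∀ t ∈ Ioo (-ε) ε, dist (γ t a) (γ t a') ^ 2 = dist (p a) (p a') ^ 2 + t := by
    intro t ht
    have := congrFun (hγ t (hball ht).1) ⟨s(a, a'), haa'⟩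
    simpa [lenSq_mk, w] using this
  refine ⟨ε, γ, hε, hγc.mono fun t ht => (hball ht).1, hγ0, hbar, hdiag, fun t ht => (hball ht).2,
    ?_⟩
  obtain ⟨N, hN, huniq⟩ := exists_nhds_eq_of_lenSq_eq h.1 hne
  -- The only parameter at which `γ` can be rigidly equivalent to `q`.
  let τ : (V → Space3) → ℝ := fun q => dist (q a) (q a') ^ 2 - dist (p a) (p a') ^ 2
  have hτ : Continuous τ := by fun_prop
  have hτ0 : τ p = 0 := sub_self _
  have hγτ : ContinuousAt (fun q => γ (τ q)) p := by
    refine ContinuousAt.comp (g := γ) ?_ hτ.continuousAt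
    rwa [hτ0]
  let tri : (V → Space3) → Fin 3 → Space3 := fun q => ![q a, q a', q b]
  have htri : Continuous tri := by
    refine continuous_pi fun i => ?_
    fin_cases i <;> simp [tri] <;> fun_prop
  -- `q` is moved rigidly so that its triangle lies on that of `γ (τ q)`. Continuity at `p` keeps
  -- the result in the neighbourhood `N`, where the lengths and the triangle determine the
  -- placement.
  let al : (V → Space3) → V → Space3 := fun q v => alignPoint 1 (tri q) (tri (γ (τ q))) (q v)
  have hal : ContinuousAt al p := by
    refine continuousAt_pi.2 fun v => ?_
    rw [← continuousWithinAt_univ]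
    refine continuousWithinAt_alignPoint 1 htri.continuousWithinAt ?_ ?_ ?_
    · exact (htri.continuousAt.comp hγτ).continuousWithinAt
    · exact (continuous_apply v).continuousWithinAt
    · simpa [tri] using hne
  have hal0 : al p = p := by
    funext v
    simp only [al, hτ0, hγ0, alignPoint]
    rw [alignVec_self (by simpa [tri] using hne)]
    abel
  have hU : ∀ᶠ q in 𝓝 p, τ q ∈ Ioo (-ε) ε ∧ cross3 (q a' - q a) (q b - q a) ≠ 0 ∧
      al q ∈ N ∧ γ (τ q) ∈ N := by
    refine Filter.Eventually.and ?_ (Filter.Eventually.and ?_ (Filter.Eventually.and ?_ ?_))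
    · exact hτ.continuousAt.preimage_mem_nhds
        (by rw [hτ0]; exact Ioo_mem_nhds (by linarith) hε)
    · exact hcr.continuousAt.eventually_ne hne
    · exact hal.preimage_mem_nhds (by rwa [hal0])
    · exact hγτ.preimage_mem_nhds (by rwa [hτ0, hγ0])
  refine ⟨_, hU, fun q hq hbars => ⟨τ q, hq.1, ?_⟩⟩
  obtain ⟨hqτ, hqne, hqal, hqγ⟩ := hq
  have hall : ∀ i j, G.Adj i j → dist (γ (τ q) i) (γ (τ q) j) = dist (q i) (q j) := by
    intro i j hij
    by_cases he : s(i, j) = s(a, a')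
    · rw [← sq_eq_sq₀ dist_nonneg dist_nonneg, ← lenSq_mk, ← lenSq_mk, he, lenSq_mk, lenSq_mk,
        hdiag _ hqτ]
      simp [τ]
    · have hadj : (G.deleteEdges {s(a, a')}).Adj i j := by
        rw [SimpleGraph.deleteEdges_adj]
        exact ⟨hij, he⟩
      rw [hbar _ hqτ i j hadj, hbars i j hadj]
  have hcong : ∀ i j, dist (tri (γ (τ q)) i) (tri (γ (τ q)) j) = dist (tri q i) (tri q j) := by
    intro i j
    fin_cases i <;> fin_cases j <;>
      simp [tri, hall _ _ haa', hall _ _ hab, hall _ _ ha'b, hall _ _ haa'.symm, hall _ _ hab.symm,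
        hall _ _ ha'b.symm]
  obtain ⟨g, hg1, hgal, hgtri⟩ := exists_isometry_eq_alignPoint (σ := 1) (by norm_num) hcong
    (by simpa [tri] using hqne)
  have hgal' : ∀ v, al q v = g (q v) := fun v => (hgal _).symm
  have heq : al q = γ (τ q) := by
    refine huniq _ hqal _ hqγ (fun e => ?_) ?_ ?_ ?_
    · obtain ⟨e, he⟩ := e
      induction e with
      | h i j => rw [lenSq_mk, lenSq_mk, hgal', hgal', g.dist_map, hall i j he]
    · rw [hgal']; exact hgtri 0
    · rw [hgal']; exact hgtri 1
    · rw [hgal']; exact hgtri 2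
  refine ⟨g.symm, isometryDet_symm hg1, fun v => ?_⟩
  rw [← heq, hgal', g.symm_apply_apply]

end Frameworks

/-! ### Mirror planes -/

namespace MirrorPlane

theorem isometryDet_reflection (π : MirrorPlane) : isometryDet π.reflection = -1 := by
  have := π.nonempty
  have h1 : Module.finrank ℝ π.carrier.directionᗮ = 1 := by
    have h2 := π.carrier.direction.finrank_add_finrank_orthogonal
    rw [π.finrank_direction, finrank_euclideanSpace_fin] at h2
    omega
  have h3 := π.carrier.direction.det_reflection
  rw [h1, pow_one] at h3
  rw [← h3]
  rfl

theorem reflection_reflection (π : MirrorPlane) (x : Space3) :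
    π.reflection (π.reflection x) = x := by
  have := π.nonempty
  exact EuclideanGeometry.reflection_reflection π.carrier x

theorem reflection_of_mem {π : MirrorPlane} {x : Space3} (hx : x ∈ π.carrier) :
    π.reflection x = x := by
  have := π.nonempty
  exact EuclideanGeometry.reflection_eq_self_iff x |>.2 hx

/-- Two points at equal distances from `a` and `a'` are swapped by the reflection in some plane
through `a` and `a'`. -/
theorem exists_isSymmetryPlane {a b a' b' : Space3} (h : cross3 (a' - a) (b - a) ≠ 0)
    (ha : dist a b = dist a b') (ha' : dist a' b = dist a' b') :
    ∃ π : MirrorPlane, π.IsSymmetryPlane a b a' b' := by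
  -- Distinct vertices may share a position. Then the perpendicular bisector degenerates, and the
  -- plane of the triangle serves instead.
  by_cases hb : b = b'
  · subst hb
    set n := cross3 (a' - a) (b - a)
    let s : AffineSubspace ℝ Space3 := AffineSubspace.mk' a (ℝ ∙ n)ᗮ
    have hmem : ∀ x, inner ℝ n (x - a) = 0 → x ∈ s := fun x hx => by
      rw [AffineSubspace.mem_mk']
      exact Submodule.mem_orthogonal_singleton_iff_inner_right.2 hx
    have : Fact (Module.finrank ℝ Space3 = 2 + 1) := ⟨by simp⟩
    let π : MirrorPlane :=
      { carrier := s
        nonempty := ⟨⟨a, AffineSubspace.self_mem_mk' _ _⟩⟩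
        finrank_direction := by
          rw [AffineSubspace.direction_mk']
          exact Submodule.finrank_orthogonal_span_singleton h }
    have hb' : π.reflection b = b := reflection_of_mem (hmem b (by
      rw [real_inner_comm]; exact inner_right_cross3 _ _))
    exact ⟨π, AffineSubspace.self_mem_mk' _ _, hmem a' (by
      rw [real_inner_comm]; exact inner_left_cross3 _ _), hb', hb'⟩
  · let s : AffineSubspace ℝ Space3 := AffineSubspace.perpBisector b b'
    have : Fact (Module.finrank ℝ Space3 = 2 + 1) := ⟨by simp⟩
    have hm : midpoint ℝ b b' ∈ s := AffineSubspace.midpoint_mem_perpBisector b b'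
    let π : MirrorPlane :=
      { carrier := s
        nonempty := ⟨⟨_, hm⟩⟩
        finrank_direction := by
          rw [AffineSubspace.direction_perpBisector]
          exact Submodule.finrank_orthogonal_span_singleton
            (vsub_ne_zero.2 (Ne.symm hb)) }
    have hrefl : π.reflection b = b' := by
      have := π.nonempty
      have hv : b - midpoint ℝ b b' ∈ s.directionᗮ := by
        rw [AffineSubspace.direction_perpBisector, Submodule.orthogonal_orthogonal,
          Submodule.mem_span_singleton]
        refine ⟨-(1 / 2 : ℝ), ?_⟩
        rw [midpoint_eq_smul_add, vsub_eq_sub, invOf_eq_inv]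
        module
      have h1 := EuclideanGeometry.reflection_orthogonal_vadd hm hv
      rw [vadd_eq_add, vadd_eq_add, sub_add_cancel] at h1
      refine h1.trans ?_
      rw [midpoint_eq_smul_add, invOf_eq_inv]
      module
    exact ⟨π, AffineSubspace.mem_perpBisector_iff_dist_eq.2 ha,
      AffineSubspace.mem_perpBisector_iff_dist_eq.2 ha', hrefl, by
        rw [← hrefl, reflection_reflection]⟩

end MirrorPlane

/-! ### The edges of the twinned polyhedron -/

namespace TriangulatedFigure

section Edges

variable {V : Type*} [DecidableEq V] {P : TriangulatedFigure V} {A B A' B' : V}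

theorem IsPolyhedron.ne_of_face (hP : P.IsPolyhedron) {a b c : V} (h : {a, b, c} ∈ P.faces) :
    a ≠ b ∧ a ≠ c ∧ b ≠ c := by
  have h3 := hP.card_face _ h
  refine ⟨?_, ?_, ?_⟩ <;> rintro rfl
  · have := Finset.card_le_two (a := a) (b := c)
    simp at h3
    omega
  · have := Finset.card_le_two (a := a) (b := b)
    rw [Finset.insert_eq_of_mem (by simp)] at h3
    have := Finset.card_le_two (a := b) (b := a)
    omega
  · have := Finset.card_le_two (a := a) (b := b)
    simp at h3
    omega

/-- The edges of the cap are the edges of the polyhedron other than `AA'`. -/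
theorem IsPolyhedron.capFaces_adj_iff (hP : P.IsPolyhedron) (hBB' : B ≠ B')
    (hface : {A, B, A'} ∈ P.faces) (hface' : {A, A', B'} ∈ P.faces) (u v : V) :
    (u ≠ v ∧ ∃ f ∈ P.capFaces A B A' B', u ∈ f ∧ v ∈ f) ↔
      (P.edgeGraph.deleteEdges {s(A, A')}).Adj u v := by
  obtain ⟨hAB, hAA', hBA'⟩ := hP.ne_of_face hface
  obtain ⟨-, hAB', hA'B'⟩ := hP.ne_of_face hface'
  have hne : ({A, B, A'} : Finset V) ≠ {A, A', B'} := by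
    intro h
    have : B ∈ ({A, A', B'} : Finset V) := by rw [← h]; simp
    simp only [Finset.mem_insert, Finset.mem_singleton] at this
    rcases this with h | h | h
    exacts [hAB h.symm, hBA' h, hBB' h]
  -- An edge lies on exactly two faces, so an edge on both removed faces lies on no other.
  have hsub : ∀ x y, ({A, B, A'} : Finset V) ∈ P.faces.filter (fun f => x ∈ f ∧ y ∈ f) →
      ({A, A', B'} : Finset V) ∈ P.faces.filter (fun f => x ∈ f ∧ y ∈ f) →
      P.edgeGraph.Adj x y →
      P.faces.filter (fun f => x ∈ f ∧ y ∈ f) = {{A, B, A'}, {A, A', B'}} := by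
    intro x y h1 h2 hxy
    refine (Finset.eq_of_subset_of_card_le ?_ ?_).symm
    · intro f hf
      rw [Finset.mem_insert, Finset.mem_singleton] at hf
      rcases hf with rfl | rfl
      exacts [h1, h2]
    · rw [hP.two_faces x y hxy, Finset.card_pair hne]
  rw [SimpleGraph.deleteEdges_adj, mem_singleton_iff]
  constructor
  · rintro ⟨huv, f, hf, hu, hv⟩
    rw [capFaces, Finset.mem_sdiff] at hf
    refine ⟨⟨huv, f, hf.1, hu, hv⟩, fun he => hf.2 ?_⟩
    have hA : A ∈ f ∧ A' ∈ f := by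
      rw [Sym2.eq_iff] at he
      rcases he with ⟨rfl, rfl⟩ | ⟨rfl, rfl⟩
      exacts [⟨hu, hv⟩, ⟨hv, hu⟩]
    rw [← hsub A A' (by simp [hface]) (by simp [hface']) ⟨hAA', _, hface, by simp, by simp⟩]
    exact Finset.mem_filter.2 ⟨hf.1, hA⟩
  · rintro ⟨hadj, he⟩
    refine ⟨hadj.1, ?_⟩
    -- An edge lost from the cap would have the two removed faces as its two faces; their only
    -- common vertices are `A` and `A'`.
    by_contra! hcon
    have hall : ∀ f ∈ P.faces.filter (fun f => u ∈ f ∧ v ∈ f),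
        f ∈ ({{A, B, A'}, {A, A', B'}} : Finset (Finset V)) := by
      intro f hf
      rw [Finset.mem_filter] at hf
      by_contra hf2
      exact hcon f (Finset.mem_sdiff.2 ⟨hf.1, hf2⟩) hf.2.1 hf.2.2
    have heq := Finset.eq_of_subset_of_card_le hall
      (by rw [hP.two_faces u v hadj, Finset.card_pair hne])
    have h1 : ({A, B, A'} : Finset V) ∈ P.faces.filter (fun f => u ∈ f ∧ v ∈ f) := by
      rw [heq]; simp
    have h2 : ({A, A', B'} : Finset V) ∈ P.faces.filter (fun f => u ∈ f ∧ v ∈ f) := by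
      rw [heq]; simp
    simp only [Finset.mem_filter, Finset.mem_insert, Finset.mem_singleton] at h1 h2
    have huv := hadj.1
    have key : ∀ x, (x = A ∨ x = B ∨ x = A') → (x = A ∨ x = A' ∨ x = B') → x = A ∨ x = A' := by
      rintro x (h | rfl | h) h'
      · exact Or.inl h
      · rcases h' with h | h | h
        exacts [Or.inl h, Or.inr h, absurd h hBB']
      · exact Or.inr h
    apply he
    rw [Sym2.eq_iff]
    rcases key u h1.2.1 h2.2.1 with rfl | rfl <;> rcases key v h1.2.2 h2.2.2 with rfl | rfl
    · exact absurd rfl huv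
    · exact Or.inl ⟨rfl, rfl⟩
    · exact Or.inr ⟨rfl, rfl⟩
    · exact absurd rfl huv

theorem mirrorVertex_of_mem {v : V} (h : v ∈ ({A, B, A', B'} : Finset V)) :
    mirrorVertex A B A' B' v = Sum.inl (Equiv.swap B B' v) := dif_pos h

theorem mirrorVertex_of_notMem {v : V} (h : v ∉ ({A, B, A', B'} : Finset V)) :
    mirrorVertex A B A' B' v = Sum.inr ⟨v, h⟩ := dif_neg h

theorem mirrorVertex_injective (A B A' B' : V) : Function.Injective (mirrorVertex A B A' B') := by
  intro u v huv
  by_cases hu : u ∈ ({A, B, A', B'} : Finset V) <;> by_cases hv : v ∈ ({A, B, A', B'} : Finset V)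
  · rw [mirrorVertex_of_mem hu, mirrorVertex_of_mem hv] at huv
    exact (Equiv.swap B B').injective (Sum.inl.inj huv)
  · rw [mirrorVertex_of_mem hu, mirrorVertex_of_notMem hv] at huv
    cases huv
  · rw [mirrorVertex_of_notMem hu, mirrorVertex_of_mem hv] at huv
    cases huv
  · rw [mirrorVertex_of_notMem hu, mirrorVertex_of_notMem hv] at huv
    exact congrArg Subtype.val (Sum.inr.inj huv)

/-- A placement of the twin keeps all bar lengths if and only if its restrictions to both caps do. -/
theorem IsPolyhedron.sameBarLengths_twin_iff (hP : P.IsPolyhedron) (hBB' : B ≠ B')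
    (hface : {A, B, A'} ∈ P.faces) (hface' : {A, A', B'} ∈ P.faces) (π : MirrorPlane)
    (p q : TwinVertex A B A' B' → Space3) :
    SameBarLengths (P.twin A B A' B' π).edgeGraph p q ↔
      SameBarLengths (P.edgeGraph.deleteEdges {s(A, A')}) (p ∘ Sum.inl) (q ∘ Sum.inl) ∧
      SameBarLengths (P.edgeGraph.deleteEdges {s(A, A')}) (p ∘ mirrorVertex A B A' B')
        (q ∘ mirrorVertex A B A' B') := by
  simp only [SameBarLengths, ← hP.capFaces_adj_iff hBB' hface hface']
  constructor
  · refine fun h => ⟨?_, ?_⟩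
    · rintro i j ⟨hij, f, hf, hi, hj⟩
      refine h _ _ ⟨fun he => hij (Sum.inl.inj he), f.image Sum.inl, ?_,
        Finset.mem_image_of_mem _ hi, Finset.mem_image_of_mem _ hj⟩
      exact Finset.mem_union_left _ (Finset.mem_image_of_mem _ hf)
    · rintro i j ⟨hij, f, hf, hi, hj⟩
      refine h _ _ ⟨fun he => hij (mirrorVertex_injective _ _ _ _ he),
        f.image (mirrorVertex A B A' B'), ?_,
        Finset.mem_image_of_mem _ hi, Finset.mem_image_of_mem _ hj⟩
      exact Finset.mem_union_right _ (Finset.mem_image_of_mem _ hf)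
  · rintro ⟨h1, h2⟩ x y ⟨hxy, f, hf, hx, hy⟩
    rcases Finset.mem_union.1 hf with hf | hf <;> obtain ⟨f, hf', rfl⟩ := Finset.mem_image.1 hf <;>
      obtain ⟨i, hi, rfl⟩ := Finset.mem_image.1 hx <;>
      obtain ⟨j, hj, rfl⟩ := Finset.mem_image.1 hy
    · exact h1 i j ⟨fun he => hxy (by rw [he]), f, hf', hi, hj⟩
    · exact h2 i j ⟨fun he => hxy (by rw [he]), f, hf', hi, hj⟩

/-- The glued vertices keep their positions in `P`; the symmetry of the equator in `π` makes these
the mirror images as well. -/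
theorem twin_pos_mirrorVertex (hAB : A ≠ B) (hAB' : A ≠ B') (hA'B : A' ≠ B) (hA'B' : A' ≠ B')
    {π : MirrorPlane} (hπ : π.IsSymmetryPlane (P.pos A) (P.pos B) (P.pos A') (P.pos B')) (v : V) :
    (P.twin A B A' B' π).pos (mirrorVertex A B A' B' v) = π.reflection (P.pos v) := by
  obtain ⟨hA, hA', hB, hB'⟩ := hπ
  by_cases hv : v ∈ ({A, B, A', B'} : Finset V)
  · rw [mirrorVertex_of_mem hv]
    change P.pos _ = _
    simp only [Finset.mem_insert, Finset.mem_singleton] at hv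
    rcases hv with rfl | rfl | rfl | rfl
    · rw [Equiv.swap_apply_of_ne_of_ne hAB hAB', MirrorPlane.reflection_of_mem hA]
    · rw [Equiv.swap_apply_left, hB]
    · rw [Equiv.swap_apply_of_ne_of_ne hA'B hA'B', MirrorPlane.reflection_of_mem hA']
    · rw [Equiv.swap_apply_right, hB']
  · rw [mirrorVertex_of_notMem hv]
    rfl

end Edges

/-! ### The flex of the twinned polyhedron -/

variable {V : Type*} [Fintype V] [DecidableEq V] {P : TriangulatedFigure V} {A B A' B' : V}

theorem IsPolyhedron.hasSingleFlex_twin (hP : P.IsPolyhedron) (hiso : P.IsIsostatic)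
    (hBB' : B ≠ B') (hface : {A, B, A'} ∈ P.faces) (hface' : {A, A', B'} ∈ P.faces)
    (hA : dist (P.pos A) (P.pos B) = dist (P.pos A) (P.pos B'))
    (hA' : dist (P.pos A') (P.pos B) = dist (P.pos A') (P.pos B')) {π : MirrorPlane}
    (hπ : π.IsSymmetryPlane (P.pos A) (P.pos B) (P.pos A') (P.pos B')) :
    (P.twin A B A' B' π).HasSingleFlex := by
  obtain ⟨hAB, hAA', hBA'⟩ := hP.ne_of_face hface
  obtain ⟨-, hAB', hA'B'⟩ := hP.ne_of_face hface'
  set C := P.edgeGraph.deleteEdges {s(A, A')} with hC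
  set μ := mirrorVertex A B A' B' with hμ
  have hμA : μ A = Sum.inl A := by
    rw [hμ, mirrorVertex_of_mem (by simp), Equiv.swap_apply_of_ne_of_ne hAB hAB']
  have hμA' : μ A' = Sum.inl A' := by
    rw [hμ, mirrorVertex_of_mem (by simp), Equiv.swap_apply_of_ne_of_ne hBA'.symm hA'B']
  have hμB : μ B = Sum.inl B' := by
    rw [hμ, mirrorVertex_of_mem (by simp), Equiv.swap_apply_left]
  have hμB' : μ B' = Sum.inl B := by
    rw [hμ, mirrorVertex_of_mem (by simp), Equiv.swap_apply_right]
  have hpμ : (P.twin A B A' B' π).pos ∘ μ = fun v => π.reflection (P.pos v) :=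
    funext (twin_pos_mirrorVertex hAB hAB' hBA'.symm hA'B' hπ)
  have eAA' : P.edgeGraph.Adj A A' := ⟨hAA', _, hface, by simp, by simp⟩
  have eAB : P.edgeGraph.Adj A B := ⟨hAB, _, hface, by simp, by simp⟩
  have eA'B : P.edgeGraph.Adj A' B := ⟨hBA'.symm, _, hface, by simp, by simp⟩
  have cAB : C.Adj A B := by
    rw [hC, SimpleGraph.deleteEdges_adj]; exact ⟨eAB, by simp [hBA', hAA']⟩
  have cA'B : C.Adj A' B := by
    rw [hC, SimpleGraph.deleteEdges_adj]; exact ⟨eA'B, by simp [hAB.symm, hBA', hAA'.symm]⟩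
  have cAB' : C.Adj A B' := by
    rw [hC, SimpleGraph.deleteEdges_adj]
    exact ⟨⟨hAB', _, hface', by simp, by simp⟩, by simp [hA'B'.symm, hAA']⟩
  have cA'B' : C.Adj A' B' := by
    rw [hC, SimpleGraph.deleteEdges_adj]
    exact ⟨⟨hA'B', _, hface', by simp, by simp⟩, by simp [hAB'.symm, hAA'.symm]⟩
  obtain ⟨ε, γ, hε, hγc, hγ0, hγbar, hγdiag, hγne, U, hU, hγuniq⟩ :=
    hiso.exists_flex eAA' eAB eA'B
  -- the reversed copy of the cap is carried by an orientation-reversing isometry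
  let tri : ℝ → Fin 3 → Space3 := fun t => ![γ t A, γ t A', γ t B]
  let tri' : ℝ → Fin 3 → Space3 := fun t => ![γ t A, γ t A', γ t B']
  have hcong : ∀ t ∈ Ioo (-ε) ε, ∀ i j, dist (tri' t i) (tri' t j) = dist (tri t i) (tri t j) := by
    intro t ht i j
    have h1 : dist (γ t A) (γ t B') = dist (γ t A) (γ t B) := by
      rw [hγbar t ht _ _ cAB', hγbar t ht _ _ cAB, hA]
    have h2 : dist (γ t A') (γ t B') = dist (γ t A') (γ t B) := by
      rw [hγbar t ht _ _ cA'B', hγbar t ht _ _ cA'B, hA']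
    have h3 : dist (γ t B') (γ t A) = dist (γ t B) (γ t A) := by rw [dist_comm, h1, dist_comm]
    have h4 : dist (γ t B') (γ t A') = dist (γ t B) (γ t A') := by rw [dist_comm, h2, dist_comm]
    fin_cases i <;> fin_cases j <;> simp [tri, tri', h1, h2, h3, h4]
  have hiso' : ∀ t ∈ Ioo (-ε) ε, ∃ g : Space3 ≃ᵃⁱ[ℝ] Space3, isometryDet g = -1 ∧
      (∀ z, g z = alignPoint (-1) (tri t) (tri' t) z) ∧ g (γ t A) = γ t A ∧
      g (γ t A') = γ t A' ∧ g (γ t B) = γ t B' ∧ g (γ t B') = γ t B := by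
    intro t ht
    obtain ⟨g, hg1, hgal, hg⟩ := exists_isometry_eq_alignPoint (σ := -1) (by norm_num)
      (hcong t ht) (by simpa [tri] using hγne t ht)
    exact ⟨g, hg1, hgal, hg 0, hg 1, hg 2, affineIsometry_swap hg1 (hγne t ht) (hg 0) (hg 1) (hg 2)⟩
  let Γ : ℝ → TwinVertex A B A' B' → Space3 := fun t =>
    Sum.elim (γ t) fun v => alignPoint (-1) (tri t) (tri' t) (γ t v)
  have hΓinl : ∀ t, Γ t ∘ Sum.inl = γ t := fun t => rfl
  -- On the equator the second cap uses vertices of the first; the swap of `B` and `B'` by `g` makes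
  -- the two prescriptions agree.
  have hΓμ : ∀ t ∈ Ioo (-ε) ε, ∀ g : Space3 ≃ᵃⁱ[ℝ] Space3,
      (∀ z, g z = alignPoint (-1) (tri t) (tri' t) z) → g (γ t A) = γ t A →
      g (γ t A') = γ t A' → g (γ t B) = γ t B' → g (γ t B') = γ t B →
      ∀ v, Γ t (μ v) = g (γ t v) := by
    intro t ht g hgal hgA hgA' hgB hgB' v
    by_cases hv : v ∈ ({A, B, A', B'} : Finset V)
    · simp only [Finset.mem_insert, Finset.mem_singleton] at hv
      rcases hv with rfl | rfl | rfl | rfl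
      · rw [hμA, hgA]; rfl
      · rw [hμB, hgB]; rfl
      · rw [hμA', hgA']; rfl
      · rw [hμB', hgB']; rfl
    · rw [hμ, mirrorVertex_of_notMem hv, hgal]; rfl
  -- The distance of `A` and `A'` is a rigid invariant that separates parameters. It serves both to
  -- distinguish the members of the family and to match the two caps.
  have hdiagU : ∀ s ∈ Ioo (-ε) ε, ∀ t ∈ Ioo (-ε) ε,
      dist (γ s A) (γ s A') = dist (γ t A) (γ t A') → s = t := by
    intro s hs t ht h
    have h1 := hγdiag s hs
    rw [h, hγdiag t ht] at h1
    linarith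
  have h0 : (0 : ℝ) ∈ Ioo (-ε) ε := ⟨by linarith, hε⟩
  refine ⟨ε, Γ, hε, ?_, ?_, ?_, ?_, ?_⟩
  · have hγv : ∀ v, ContinuousOn (fun t => γ t v) (Ioo (-ε) ε) := continuousOn_pi.1 hγc
    have htri : ContinuousOn tri (Ioo (-ε) ε) := by
      refine continuousOn_pi.2 fun i => ?_
      fin_cases i
      exacts [hγv A, hγv A', hγv B]
    have htri' : ContinuousOn tri' (Ioo (-ε) ε) := by
      refine continuousOn_pi.2 fun i => ?_
      fin_cases i
      exacts [hγv A, hγv A', hγv B']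
    refine continuousOn_pi.2 fun x => ?_
    rcases x with v | v
    · exact hγv v
    · intro t ht
      exact continuousWithinAt_alignPoint (-1) (htri t ht) (htri' t ht) (hγv v t ht)
        (by simpa [tri] using hγne t ht)
  · obtain ⟨g, hg1, hgal, hgA, hgA', hgB, hgB'⟩ := hiso' 0 h0
    have hgπ : ∀ z, g z = π.reflection z := by
      have hne := hγne 0 h0
      obtain ⟨πA, πA', πB, πB'⟩ := hπ
      refine affineIsometry_eq_of_triangle (hg1.trans π.isometryDet_reflection.symm) hne ?_ ?_ ?_
      · rw [hgA, hγ0, MirrorPlane.reflection_of_mem πA]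
      · rw [hgA', hγ0, MirrorPlane.reflection_of_mem πA']
      · rw [hgB, hγ0, πB]
    funext x
    rcases x with v | v
    · change γ 0 v = P.pos v
      rw [hγ0]
    · change alignPoint (-1) (tri 0) (tri' 0) (γ 0 v) = π.reflection (P.pos v)
      rw [← hgal, hgπ, hγ0]
  · intro t ht
    obtain ⟨g, hg1, hgal, hgA, hgA', hgB, hgB'⟩ := hiso' t ht
    rw [hP.sameBarLengths_twin_iff hBB' hface hface']
    refine ⟨hγbar t ht, fun i j hij => ?_⟩
    have hm := hΓμ t ht g hgal hgA hgA' hgB hgB'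
    have hp : ∀ v, (P.twin A B A' B' π).pos (μ v) = π.reflection (P.pos v) := congrFun hpμ
    change dist (Γ t (μ i)) (Γ t (μ j)) = dist ((P.twin A B A' B' π).pos (μ i))
      ((P.twin A B A' B' π).pos (μ j))
    rw [hm, hm, hp, hp, g.dist_map, π.reflection.dist_map]
    exact hγbar t ht i j hij
  · intro s hs t ht hst
    exact hdiagU s hs t ht (hst.dist_eq (Sum.inl A) (Sum.inl A')).symm
  · let r1 : (TwinVertex A B A' B' → Space3) → V → Space3 := fun q => q ∘ Sum.inl
    -- Reflecting the second cap back in `π` gives a placement close to that of `P`, to which the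
    -- local uniqueness of the cap's flex applies.
    let r2 : (TwinVertex A B A' B' → Space3) → V → Space3 := fun q v => π.reflection (q (μ v))
    have hr1 : Continuous r1 := continuous_pi fun v => continuous_apply _
    have hr2 : Continuous r2 := continuous_pi fun v =>
      π.reflection.continuous.comp (continuous_apply _)
    have hr20 : r2 (P.twin A B A' B' π).pos = P.pos := by
      funext v
      change π.reflection ((P.twin A B A' B' π).pos (μ v)) = _
      rw [show (P.twin A B A' B' π).pos (μ v) = _ from congrFun hpμ v, π.reflection_reflection]
    refine ⟨r1 ⁻¹' U ∩ r2 ⁻¹' U, Filter.inter_mem (hr1.continuousAt.preimage_mem_nhds hU)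
      (hr2.continuousAt.preimage_mem_nhds (by rwa [hr20])), fun q hq hbars => ?_⟩
    rw [hP.sameBarLengths_twin_iff hBB' hface hface'] at hbars
    obtain ⟨t, ht, f₁, hf₁, hq₁⟩ := hγuniq _ hq.1 hbars.1
    obtain ⟨t', ht', f₂, hf₂, hq₂⟩ := hγuniq _ hq.2 (by
      intro i j hij
      have h1 := hbars.2 i j hij
      rw [← hμ, hpμ, π.reflection.dist_map] at h1
      rw [← h1]
      exact π.reflection.dist_map _ _)
    have hq₁' : ∀ v, q (Sum.inl v) = f₁ (γ t v) := hq₁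
    have hq₂' : ∀ v, q (μ v) = π.reflection (f₂ (γ t' v)) := fun v => by
      rw [← hq₂ v, π.reflection_reflection]
    obtain rfl : t = t' := by
      refine hdiagU t ht t' ht' ?_
      rw [← f₁.dist_map, ← hq₁', ← hq₁', ← hμA, ← hμA', hq₂', hq₂', π.reflection.dist_map,
        f₂.dist_map]
    obtain ⟨g, hg1, hgal, hgA, hgA', hgB, hgB'⟩ := hiso' t ht
    -- Both sides reverse orientation, and they agree on the triangle `AA'B` because `q` has one
    -- value at each glued vertex. So `f₁` carries the mirrored cap to its place as well.
    have hcomp : ∀ z, (g.trans f₁) z = (f₂.trans π.reflection) z := by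
      refine affineIsometry_eq_of_triangle ?_ (hγne t ht) ?_ ?_ ?_
      · rw [isometryDet_trans, isometryDet_trans, hg1, π.isometryDet_reflection,
          show isometryDet f₁ = 1 from hf₁, show isometryDet f₂ = 1 from hf₂]
        norm_num
      · change f₁ (g (γ t A)) = π.reflection (f₂ (γ t A))
        rw [hgA, ← hq₁', ← hq₂', hμA]
      · change f₁ (g (γ t A')) = π.reflection (f₂ (γ t A'))
        rw [hgA', ← hq₁', ← hq₂', hμA']
      · change f₁ (g (γ t B)) = π.reflection (f₂ (γ t B))
        rw [hgB, ← hq₁', ← hq₂', hμB]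
    refine ⟨t, ht, f₁, hf₁, fun x => ?_⟩
    rcases x with v | v
    · exact hq₁' v
    · change _ = f₁ (alignPoint (-1) (tri t) (tri' t) (γ t v))
      rw [← hgal]
      have h1 : μ (v : V) = Sum.inr v := mirrorVertex_of_notMem v.2
      rw [← h1, hq₂']
      exact (hcomp _).symm

end TriangulatedFigure

theorem mainTheorem2 {V : Type*} [Fintype V] [DecidableEq V]
    (P : TriangulatedFigure V) (hP : P.IsPolyhedron) (hiso : P.IsIsostatic)
    (A B A' B' : V) (hBB' : B ≠ B')
    (hface : {A, B, A'} ∈ P.faces) (hface' : {A, A', B'} ∈ P.faces)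
    (hA : dist (P.pos A) (P.pos B) = dist (P.pos A) (P.pos B'))
    (hA' : dist (P.pos A') (P.pos B) = dist (P.pos A') (P.pos B')) :
    (∃ π : MirrorPlane, π.IsSymmetryPlane (P.pos A) (P.pos B) (P.pos A') (P.pos B')) ∧
    ∀ π : MirrorPlane, π.IsSymmetryPlane (P.pos A) (P.pos B) (P.pos A') (P.pos B') →
      (P.twin A B A' B' π).HasSingleFlex := by
  refine ⟨?_, fun π hπ => hP.hasSingleFlex_twin hiso hBB' hface hface' hA hA' hπ⟩
  obtain ⟨hAB, hAA', hBA'⟩ := hP.ne_of_face hface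
  refine MirrorPlane.exists_isSymmetryPlane ?_ hA hA'
  exact cross3_ne_zero_of_linearIndependent hiso.2 ⟨hAA', _, hface, by simp, by simp⟩
    ⟨hAB, _, hface, by simp, by simp⟩ ⟨hBA'.symm, _, hface, by simp, by simp⟩
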